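/- Let $d\ge 2$ and let $\Omega_0\subset\Omega_1$ be bounded open sets in $\mathbb{R}^d$. For an open set $\Omega\subset\mathbb{R}^d$ let $H^1_0(\Omega)$ be the closure of $C_c^\infty(\Omega)$ in $H^1(\mathbb{R}^d)$ (functions being extended by zero outside $\Omega$). For a bounded open set $\Omega$ and $f\in L^2(\mathbb{R}^d)$ let $u_{\Omega,f}\in H^1_0(\Omega)$ be the unique weak solution of $-\Delta u=f$ in $\Omega$, $u\in H^1_0(\Omega)$, that is, $$\int\nabla u_{\Omega,f}\cdot\nabla\varphi\,dx=\int f\varphi\,dx\qquad\text{for all }\varphi\in H^1_0(\Omega).$$ A sequence $(A_n)$ of bounded open sets $\gamma$-converges to a bounded open set $A$ if for every $f\in L^2(\mathbb{R}^d)$ the functions $u_{A_n,f}$ converge weakly in $H^1(\mathbb{R}^d)$ to $u_{A,f}$. Then there is a family $(\Omega_t)_{t\in[0,1]}$ of open sets, with the given sets $\Omega_0$ and $\Omega_1$ as its members at $t=0$ and $t=1$, such that $\Omega_s\subset\Omega_t$ for all $0\le s<t\le1$, and which is $\gamma$-continuous: whenever $t_n\to t$ in $[0,1]$, the sets $\Omega_{t_n}$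 $\gamma$-converge to $\Omega_t$. Moreover, for every $f\in L^2(\mathbb{R}^d)$ the map $t\mapsto u_{\Omega_t,f}$ is continuous from $[0,1]$ to $H^1(\mathbb{R}^d)$ with its norm. -/

import Mathlib

open MeasureTheory Filter Topology
open scoped ContDiff

noncomputable section

namespace Dirichlet

/-- Euclidean space `ℝ^d`. -/
abbrev E (d : ℕ) : Type := EuclideanSpace ℝ (Fin d)

/-- The space `L²(ℝ^d)` of real functions. -/
abbrev L2 (d : ℕ) : Type := Lp ℝ 2 (volume : Measure (E d))

/-- The space `L²(ℝ^d; ℝ^d)` of vector fields. -/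
abbrev L2Vec (d : ℕ) : Type := Lp (E d) 2 (volume : Measure (E d))

/-- `φ ∈ C_c^∞(Ω)`: smooth on `ℝ^d`, with compact support contained in `Ω`. -/
def IsTestFunction {d : ℕ} (Ω : Set (E d)) (φ : E d → ℝ) : Prop :=
  ContDiff ℝ ∞ φ ∧ HasCompactSupport φ ∧ tsupport φ ⊆ Ω

/-- `g` is the weak (distributional) gradient of `u` on `ℝ^d`. -/
def IsWeakGradient {d : ℕ} (u : L2 d) (g : L2Vec d) : Prop :=
  ∀ φ : E d → ℝ, IsTestFunction Set.univ φ → ∀ v : E d,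
    ∫ x, u x * fderiv ℝ φ x v = - ∫ x, inner ℝ (g x) v * φ x

theorem IsTestFunction.memLp {d : ℕ} {Ω : Set (E d)} {φ : E d → ℝ}
    (h : IsTestFunction Ω φ) : MemLp φ 2 (volume : Measure (E d)) :=
  h.1.continuous.memLp_of_hasCompactSupport h.2.1

theorem IsTestFunction.memLp_fderiv {d : ℕ} {Ω : Set (E d)} {φ : E d → ℝ}
    (h : IsTestFunction Ω φ) (v : E d) :
    MemLp (fun x => fderiv ℝ φ x v) 2 (volume : Measure (E d)) := by
  refine Continuous.memLp_of_hasCompactSupport ?_ (h.2.1.fderiv_apply ℝ v)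
  exact (h.1.continuous_fderiv (by simp)).clm_apply continuous_const

theorem IsTestFunction.integrable_left {d : ℕ} {Ω : Set (E d)} {φ : E d → ℝ}
    (h : IsTestFunction Ω φ) (v : E d) (u : L2 d) :
    Integrable (fun x => u x * fderiv ℝ φ x v) :=
  (Lp.memLp u).integrable_mul (h.memLp_fderiv v)

theorem IsTestFunction.integrable_right {d : ℕ} {Ω : Set (E d)} {φ : E d → ℝ}
    (h : IsTestFunction Ω φ) (v : E d) (g : L2Vec d) :
    Integrable (fun x => inner ℝ (g x) v * φ x) :=
  ((Lp.memLp g).inner_const v).integrable_mul h.memLp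

/-- The Sobolev space `H¹(ℝ^d)`: a function of `L²` together with its weak gradient in `L²`,
with the norm `(‖u‖² + ‖∇u‖²)^(1/2)`. -/
def H1 (d : ℕ) : Submodule ℝ (WithLp 2 (L2 d × L2Vec d)) where
  carrier := {w | IsWeakGradient w.fst w.snd}
  zero_mem' := by
    intro φ hφ v
    have h1 : (fun x => ((0 : L2 d) : E d → ℝ) x * fderiv ℝ φ x v) =ᵐ[volume] fun _ => 0 := by
      filter_upwards with x
      simp
    have h2 : (fun x => inner ℝ (((0 : L2Vec d) : E d → E d) x) v * φ x)
        =ᵐ[volume] fun _ => 0 := by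
      filter_upwards with x
      simp
    simp only [WithLp.zero_fst, WithLp.zero_snd]
    rw [integral_congr_ae h1, integral_congr_ae h2]
    simp
  add_mem' := by
    intro a b ha hb φ hφ v
    have h1 : (fun x => ((a.fst + b.fst : L2 d) : E d → ℝ) x * fderiv ℝ φ x v)
        =ᵐ[volume] fun x => a.fst x * fderiv ℝ φ x v + b.fst x * fderiv ℝ φ x v := by
      filter_upwards [Lp.coeFn_add a.fst b.fst] with x hx
      simp only [hx, Pi.add_apply, add_mul]
    have h2 : (fun x => inner ℝ (((a.snd + b.snd : L2Vec d) : E d → E d) x) v * φ x)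
        =ᵐ[volume] fun x => inner ℝ (a.snd x) v * φ x + inner ℝ (b.snd x) v * φ x := by
      filter_upwards [Lp.coeFn_add a.snd b.snd] with x hx
      simp only [hx, Pi.add_apply, inner_add_left, add_mul]
    simp only [WithLp.add_fst, WithLp.add_snd]
    rw [integral_congr_ae h1, integral_congr_ae h2,
      integral_add (hφ.integrable_left v _) (hφ.integrable_left v _),
      integral_add (hφ.integrable_right v _) (hφ.integrable_right v _), ha φ hφ v, hb φ hφ v]
    ring
  smul_mem' := by
    intro c a ha φ hφ v
    have h1 : (fun x => ((c • a.fst : L2 d) : E d → ℝ) x * fderiv ℝ φ x v)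
        =ᵐ[volume] fun x => c * (a.fst x * fderiv ℝ φ x v) := by
      filter_upwards [Lp.coeFn_smul c a.fst] with x hx
      simp only [hx, Pi.smul_apply, smul_eq_mul, mul_assoc]
    have h2 : (fun x => inner ℝ (((c • a.snd : L2Vec d) : E d → E d) x) v * φ x)
        =ᵐ[volume] fun x => c * (inner ℝ (a.snd x) v * φ x) := by
      filter_upwards [Lp.coeFn_smul c a.snd] with x hx
      simp only [hx, Pi.smul_apply, real_inner_smul_left, mul_assoc]
    simp only [WithLp.smul_fst, WithLp.smul_snd]
    rw [integral_congr_ae h1, integral_congr_ae h2, integral_const_mul, integral_const_mul,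
      ha φ hφ v]
    ring

/-- The underlying `L²` function of an element of `H¹(ℝ^d)`. -/
def fn {d : ℕ} (u : H1 d) : L2 d := (u : WithLp 2 (L2 d × L2Vec d)).fst

/-- The weak gradient of an element of `H¹(ℝ^d)`. -/
def grad {d : ℕ} (u : H1 d) : L2Vec d := (u : WithLp 2 (L2 d × L2Vec d)).snd

/-- The subspace `C_c^∞(Ω)` of `H¹(ℝ^d)`. -/
def testSpace {d : ℕ} (Ω : Set (E d)) : Submodule ℝ (H1 d) where
  carrier := {u | ∃ φ : E d → ℝ, IsTestFunction Ω φ ∧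
    (fn u : E d → ℝ) =ᵐ[volume] φ ∧ (grad u : E d → E d) =ᵐ[volume] gradient φ}
  zero_mem' := by
    refine ⟨0, ⟨contDiff_const, HasCompactSupport.zero, by simp [tsupport]⟩,
      Lp.coeFn_zero ℝ 2 _, ?_⟩
    refine (Lp.coeFn_zero (E d) 2 _).trans (Eventually.of_forall fun x => ?_)
    exact (gradient_const x (0 : ℝ)).symm
  add_mem' := by
    rintro a b ⟨φ, hφ, ha, ha'⟩ ⟨ψ, hψ, hb, hb'⟩
    refine ⟨φ + ψ, ⟨hφ.1.add hψ.1, hφ.2.1.add hψ.2.1,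
      (tsupport_add φ ψ).trans (Set.union_subset hφ.2.2 hψ.2.2)⟩,
      (Lp.coeFn_add (fn a) (fn b)).trans (ha.add hb), ?_⟩
    refine (Lp.coeFn_add (grad a) (grad b)).trans ((ha'.add hb').trans
      (Eventually.of_forall fun x => ?_))
    have h1 := hφ.1.differentiable (by simp) x
    have h2 := hψ.1.differentiable (by simp) x
    simp [gradient, fderiv_add h1 h2]
  smul_mem' := by
    rintro c a ⟨φ, hφ, ha, ha'⟩
    refine ⟨c • φ, ⟨hφ.1.const_smul c, hφ.2.1.smul_left (f := fun _ => c),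
      (tsupport_smul_subset_right (fun _ => c) φ).trans hφ.2.2⟩,
      (Lp.coeFn_smul c (fn a)).trans (ha.const_smul c), ?_⟩
    refine (Lp.coeFn_smul c (grad a)).trans ((ha'.const_smul c).trans
      (Eventually.of_forall fun x => ?_))
    have h1 := hφ.1.differentiable (by simp) x
    simp [gradient, fderiv_const_smul h1 c]

/-- The space `H¹₀(Ω)`, whose elements are extended by zero outside `Ω`: the closure of
`C_c^∞(Ω)` in `H¹(ℝ^d)`. -/
def H10 {d : ℕ} (Ω : Set (E d)) : Submodule ℝ (H1 d) := (testSpace Ω).topologicalClosure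

/-- `u` is a weak solution of `-Δu = f` in `Ω`, `u ∈ H¹₀(Ω)`. -/
def IsSolution {d : ℕ} (Ω : Set (E d)) (f : L2 d) (u : H1 d) : Prop :=
  u ∈ H10 Ω ∧ ∀ φ ∈ H10 Ω, ∫ x, inner ℝ (grad u x) (grad φ x) = ∫ x, f x * fn φ x

/-- `u` is the (one and only) weak solution of `-Δu = f` in `Ω`, `u ∈ H¹₀(Ω)`. -/
def IsUniqueSolution {d : ℕ} (Ω : Set (E d)) (f : L2 d) (u : H1 d) : Prop :=
  IsSolution Ω f u ∧ ∀ v, IsSolution Ω f v → v = u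

/-- Weak convergence of sequences in `H¹(ℝ^d)`. -/
def WeakH1Tendsto {d : ℕ} (u : ℕ → H1 d) (w : H1 d) : Prop :=
  ∀ ℓ : H1 d →L[ℝ] ℝ, Tendsto (fun n => ℓ (u n)) atTop (𝓝 (ℓ w))

/-- The sequence `Ω n` γ-converges to `Ω'`: for every `f ∈ L²(ℝ^d)` the Dirichlet problems with
right-hand side `f` on all these sets have unique solutions, and those on `Ω n` converge weakly in
`H¹(ℝ^d)` to the one on `Ω'`. -/
def GammaTendsto {d : ℕ} (Ω : ℕ → Set (E d)) (Ω' : Set (E d)) : Prop :=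
  ∀ f : L2 d, ∃ (u : ℕ → H1 d) (w : H1 d),
    (∀ n, IsUniqueSolution (Ω n) f (u n)) ∧ IsUniqueSolution Ω' f w ∧ WeakH1Tendsto u w

/-- The family `Ω t`, `t ∈ [0,1]`, is γ-continuous. -/
def GammaContinuous {d : ℕ} (Ω : unitInterval → Set (E d)) : Prop :=
  ∀ (t : ℕ → unitInterval) (t' : unitInterval), Tendsto t atTop (𝓝 t') →
    GammaTendsto (fun n => Ω (t n)) (Ω t')

end Dirichlet

end

open MeasureTheory Filter Topology
open scoped ContDiff

noncomputable section

namespace Dirichlet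

/-! Choose a continuous curve `γ` that covers `Ω₁` and ends at a point `q` outside `Ω₁`, and let
`Ω_t` be `Ω₀` together with what is left of `Ω₁` after deleting `γ([t,1])`. The family increases,
equals `Ω₀` at `t = 0` because the whole curve covers `Ω₁`, and equals `Ω₁` at `t = 1` because only
`q` is deleted. Since `γ([t,1])` is compact, the sets are open.

For an increasing family with a common Poincaré constant, the solution can be discontinuous only
where the spaces `H¹₀(Ω_t)` jump (`continuous_galerkin`). From the left there is no jump: `Ω_t` is
the union of the earlier sets, so a compactly supported test function already lives in one of them
(`exists_H10_curveFamily_left`). From the right, for `s` slightly above `t`, `Ω_s` exceeds `Ω_t`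
only inside a small ball around `γ t`. A function in every `H¹₀(Ω_s)`, `s > t`, then lies in
`H¹₀(Ω_t)` because points have zero capacity when `d ≥ 2` (`mem_H10_of_punctured`).

Zero capacity is made quantitative by a log-log cut-off (`exists_cutoff`), whose gradient is
controlled by a logarithmic Hardy inequality (`hardy_log`). That inequality and the Poincaré
inequality both come from the divergence theorem for a radial field. Norm continuity of the
solutions then gives γ-continuity at once. -/

/-! ### Continuity of Galerkin solutions along a monotone family -/

/-- Galerkin solutions on a monotone family of closed subspaces depend continuously on the
parameter if the family has no jumps. -/
theorem continuous_galerkin {H F : Type*} [NormedAddCommGroup H] [InnerProductSpace ℝ H]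
    [CompleteSpace H] [NormedAddCommGroup F] [InnerProductSpace ℝ F]
    (G : H →L[ℝ] F) (V : unitInterval → Submodule ℝ H) (hmono : Monotone V)
    (hclosed : ∀ t, IsClosed (V t : Set H)) {C : ℝ} (hC0 : 0 ≤ C)
    (hC : ∀ t, ∀ x ∈ V t, ‖x‖ ≤ C * ‖G x‖) (ℓ : H → ℝ) (u : unitInterval → H)
    (hu : ∀ t, u t ∈ V t) (hsol : ∀ t, ∀ x ∈ V t, inner ℝ (G (u t)) (G x) = ℓ x)
    (hleft : ∀ t, 0 < t → ∀ x ∈ V t, ∀ ε > 0, ∃ s < t, ∃ y ∈ V s, ‖x - y‖ < ε)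
    (hright : ∀ t, t < 1 → ∀ x, (∀ s, t < s → x ∈ V s) → x ∈ V t) : Continuous u := by
  have horth : ∀ s t, s ≤ t → ∀ x ∈ V s, inner ℝ (G (u t - u s)) (G x) = 0 := by
    intro s t hst x hx
    rw [map_sub, inner_sub_left, hsol t x (hmono hst hx), hsol s x hx, sub_self]
  -- Pythagoras in the energy seminorm: the increment of the solution is orthogonal to the smaller
  -- space, so its energy is the increment of a monotone real function.
  have henergy : ∀ s t, s ≤ t →
      ‖G (u t - u s)‖ ^ 2 = ‖G (u t)‖ ^ 2 - ‖G (u s)‖ ^ 2 := by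
    intro s t hst
    have h := horth s t hst (u s) (hu s)
    have h2 := norm_add_sq_real (G (u t - u s)) (G (u s))
    rw [h, ← map_add, sub_add_cancel] at h2
    linarith
  have hbound : ∀ s t, s ≤ t → ‖u t - u s‖ ≤ C * ‖G (u t - u s)‖ := fun s t hst =>
    hC t _ ((V t).sub_mem (hu t) (hmono hst (hu s)))
  have hemono : Monotone fun t => ‖G (u t)‖ ^ 2 := by
    intro s t hst
    have := henergy s t hst
    have h0 := sq_nonneg ‖G (u t - u s)‖
    show ‖G (u s)‖ ^ 2 ≤ ‖G (u t)‖ ^ 2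
    linarith
  rw [continuous_iff_continuousAt]
  intro t
  rw [continuousAt_iff_continuous_left'_right']
  constructor
  · rcases eq_or_lt_of_le (show (0 : unitInterval) ≤ t from t.2.1) with h0 | h0
    · have : Set.Iio t = ∅ := by
        ext s
        simp [← h0]
      rw [this]
      exact continuousWithinAt_of_notMem_closure (by simp)
    · rw [Metric.continuousWithinAt_iff']
      intro ε hε
      have hK : 0 < C * ‖G‖ + 1 := by positivity
      obtain ⟨s₀, hs₀, y, hy, hxy⟩ := hleft t h0 (u t) (hu t) (ε / (C * ‖G‖ + 1)) (by positivity)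
      filter_upwards [Ioo_mem_nhdsLT hs₀] with s hs
      have hys : y ∈ V s := hmono hs.1.le hy
      -- Céa's argument: `u s` is the best approximation of `u t` from `V s` in energy, so it beats
      -- `y`.
      have h1 : ‖G (u t - u s)‖ ≤ ‖G (u t - y)‖ := by
        have h := horth s t hs.2.le (u s - y) ((V s).sub_mem (hu s) hys)
        have h2 := norm_add_sq_real (G (u t - u s)) (G (u s - y))
        rw [h, ← map_add, sub_add_sub_cancel] at h2
        refine le_of_sq_le_sq ?_ (norm_nonneg _)
        have := sq_nonneg ‖G (u s - y)‖
        linarith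
      rw [dist_comm, dist_eq_norm]
      calc ‖u t - u s‖ ≤ C * ‖G (u t - u s)‖ := hbound s t hs.2.le
        _ ≤ C * (‖G‖ * ‖u t - y‖) :=
            mul_le_mul_of_nonneg_left (h1.trans (G.le_opNorm _)) hC0
        _ = (C * ‖G‖) * ‖u t - y‖ := by ring
        _ ≤ (C * ‖G‖ + 1) * ‖u t - y‖ := by gcongr; linarith
        _ < (C * ‖G‖ + 1) * (ε / (C * ‖G‖ + 1)) := by gcongr
        _ = ε := by field_simp
  · rcases eq_or_lt_of_le (show t ≤ 1 from t.2.2) with h1 | h1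
    · have : Set.Ioi t = ∅ := by
        ext s
        simp only [Set.mem_Ioi, Set.mem_empty_iff_false, iff_false, not_lt, h1]
        exact s.2.2
      rw [this]
      exact continuousWithinAt_of_notMem_closure (by simp)
    · have hne : (𝓝[>] t).NeBot := nhdsGT_neBot_of_exists_gt ⟨1, h1⟩
      have hlim := hemono.tendsto_nhdsGT t
      -- The monotone energy has a right limit, so its increments are small near `t`; by `henergy`
      -- and the Poincaré bound, so are those of `u`. The limit lies in `V t` by `hright` and solves
      -- the same problem there, hence equals `u t`.
      have hcau : Cauchy (map u (𝓝[>] t)) := by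
        have hc := hlim.cauchy_map
        rw [Metric.cauchy_iff] at hc ⊢
        refine ⟨inferInstance, fun ε hε => ?_⟩
        obtain ⟨S, hS, hSε⟩ := hc.2 ((ε / (C + 1)) ^ 2) (by positivity)
        refine ⟨u '' ((fun t => ‖G (u t)‖ ^ 2) ⁻¹' S), image_mem_map hS, ?_⟩
        have key : ∀ r s, r ≤ s → ‖G (u r)‖ ^ 2 ∈ S → ‖G (u s)‖ ^ 2 ∈ S →
            dist (u s) (u r) < ε := by
          intro r s hrs hr hs
          have h2 := hSε _ hs _ hr
          rw [Real.dist_eq, ← henergy r s hrs, abs_of_nonneg (sq_nonneg _)] at h2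
          have h3 : ‖G (u s - u r)‖ < ε / (C + 1) := lt_of_pow_lt_pow_left₀ 2 (by positivity) h2
          rw [dist_eq_norm]
          calc ‖u s - u r‖ ≤ C * ‖G (u s - u r)‖ := hbound r s hrs
            _ ≤ (C + 1) * ‖G (u s - u r)‖ := by gcongr; linarith
            _ < (C + 1) * (ε / (C + 1)) := by gcongr
            _ = ε := by field_simp
        rintro _ ⟨r, hr, rfl⟩ _ ⟨s, hs, rfl⟩
        rcases le_total r s with h | h
        · rw [dist_comm]
          exact key r s h hr hs
        · exact key s r h hs hr
      obtain ⟨w, hw⟩ := CompleteSpace.complete hcau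
      have hw : Tendsto u (𝓝[>] t) (𝓝 w) := hw
      have hwV : w ∈ V t := by
        refine hright t h1 w fun s hs => ?_
        refine (hclosed s).mem_of_tendsto hw ?_
        filter_upwards [Ioo_mem_nhdsGT hs] with r hr
        exact hmono hr.2.le (hu r)
      have hwsol : ∀ x ∈ V t, inner ℝ (G w) (G x) = ℓ x := by
        intro x hx
        have h2 : Tendsto (fun r => inner ℝ (G (u r)) (G x)) (𝓝[>] t) (𝓝 (inner ℝ (G w) (G x))) :=
          ((G.continuous.tendsto w).comp hw).inner tendsto_const_nhds
        refine tendsto_nhds_unique h2 (tendsto_const_nhds.congr' ?_)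
        filter_upwards [self_mem_nhdsWithin] with r hr
        exact (hsol r x (hmono (le_of_lt hr) hx)).symm
      have hz := (V t).sub_mem hwV (hu t)
      have h3 : inner ℝ (G (w - u t)) (G (w - u t)) = 0 := by
        nth_rewrite 1 [map_sub]
        rw [inner_sub_left, hwsol _ hz, hsol t _ hz, sub_self]
      have h4 := hC t _ hz
      rw [inner_self_eq_zero.mp h3, norm_zero, mul_zero] at h4
      have h5 : w = u t := sub_eq_zero.mp (norm_le_zero_iff.mp h4)
      rw [ContinuousWithinAt, ← h5]
      exact hw

/-! ### A space-filling curve with prescribed endpoint -/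

/-- A continuous curve in `ℝ^d` passing through every point of a given bounded set and ending at a
given point. -/
theorem exists_spaceFilling_curve {d : ℕ} {A : Set (E d)} (hA : Bornology.IsBounded A) (q : E d) :
    ∃ γ : ℝ → E d, Continuous γ ∧ A ⊆ γ '' Set.Icc 0 1 ∧ γ 1 = q := by
  obtain ⟨R, hR⟩ := hA.subset_closedBall q
  have hq : q ∈ Metric.closedBall q (max R 0) := by simp
  have : Nonempty (Metric.closedBall q (max R 0)) := ⟨⟨q, hq⟩⟩
  have : CompactSpace (Metric.closedBall q (max R 0)) :=
    isCompact_iff_compactSpace.mp (isCompact_closedBall _ _)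
  -- Hausdorff–Alexandroff: a compact metric space is a continuous image of the Cantor set. Tietze
  -- extension of the coordinates then gives a curve on all of `ℝ`.
  obtain ⟨f, hf, hfs⟩ :=
    exists_nat_bool_continuous_surjective_of_compact (Metric.closedBall q (max R 0))
  let g : C(cantorSet, Fin d → ℝ) :=
    ⟨fun x => WithLp.ofLp (f (cantorSetHomeomorphNatToBool x) : E d), by fun_prop⟩
  obtain ⟨g', hg'⟩ := g.exists_restrict_eq isClosed_cantorSet
  let c : ℝ → E d := fun t => WithLp.toLp 2 (g' t)
  have hc : Continuous c := by fun_prop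
  -- The covering is done on `[0, 1/2]`, where the correction vanishes; on `[1/2, 1]` the correction
  -- grows linearly so that the value at `1` is `c 2 + (q - c 2) = q`.
  refine ⟨fun t => c (2 * t) + max 0 (2 * t - 1) • (q - c 2), by fun_prop, fun x hx => ?_, ?_⟩
  · obtain ⟨b, hb⟩ := hfs ⟨x, Metric.closedBall_subset_closedBall (le_max_left _ _) (hR hx)⟩
    have hz := cantorSet_subset_unitInterval (cantorSetHomeomorphNatToBool.symm b).2
    set z := cantorSetHomeomorphNatToBool.symm b with hzdef
    refine ⟨(z : ℝ) / 2, ⟨by linarith [hz.1], by linarith [hz.2]⟩, ?_⟩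
    have h1 : max 0 (2 * ((z : ℝ) / 2) - 1) = 0 := max_eq_left (by linarith [hz.2])
    have h2 : g' (z : ℝ) = g z := congrArg (fun h : C(cantorSet, Fin d → ℝ) => h z) hg'
    have h3 : 2 * ((z : ℝ) / 2) = z := by ring
    show c (2 * ((z : ℝ) / 2)) + max 0 (2 * ((z : ℝ) / 2) - 1) • (q - c 2) = x
    rw [h1, zero_smul, add_zero, h3]
    show WithLp.toLp 2 (g' (z : ℝ)) = x
    rw [h2]
    show (f (cantorSetHomeomorphNatToBool z) : E d) = x
    rw [hzdef, Homeomorph.apply_symm_apply, hb]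
  · norm_num

/-! ### Test functions in `H¹` and completeness -/

variable {d : ℕ} {Ω : Set (E d)} {φ : E d → ℝ}

theorem integral_fderiv_apply_eq_zero {F : E d → ℝ} (hF : ContDiff ℝ 1 F)
    (hc : HasCompactSupport F) (v : E d) : ∫ x, fderiv ℝ F x v = 0 := by
  have hd := hF.differentiable (by simp)
  have h1 : Integrable (fun x => fderiv ℝ F x v) :=
    ((hF.continuous_fderiv (by simp)).clm_apply continuous_const).integrable_of_hasCompactSupport
      (hc.fderiv_apply ℝ v)
  have h2 : Integrable F := hF.continuous.integrable_of_hasCompactSupport hc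
  have := integral_mul_fderiv_eq_neg_fderiv_mul_of_integrable (μ := (volume : Measure (E d)))
    (f := fun _ => (1 : ℝ)) (g := F) (v := v) (by simp) (by simpa using h1) (by simpa using h2)
    (fun _ _ => differentiableAt_const _) (fun x _ => hd x)
  simpa using this

theorem norm_gradient (φ : E d → ℝ) (x : E d) : ‖gradient φ x‖ = ‖fderiv ℝ φ x‖ := by
  simp [gradient]

theorem continuous_gradient (h : ContDiff ℝ 1 φ) : Continuous (gradient φ) := by
  unfold gradient
  exact (LinearIsometryEquiv.continuous _).comp (h.continuous_fderiv (by simp))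

theorem hasCompactSupport_gradient (h : HasCompactSupport φ) :
    HasCompactSupport (gradient φ) := by
  unfold gradient
  exact (h.fderiv ℝ).comp_left (g := (InnerProductSpace.toDual ℝ (E d)).symm) (by simp)

theorem IsTestFunction.mono {Ω' : Set (E d)} (h : IsTestFunction Ω φ) (hΩ : Ω ⊆ Ω') :
    IsTestFunction Ω' φ := ⟨h.1, h.2.1, h.2.2.trans hΩ⟩

theorem IsTestFunction.contDiff_one (h : IsTestFunction Ω φ) : ContDiff ℝ 1 φ :=
  h.1.of_le (by simp)

theorem IsTestFunction.memLp_gradient (h : IsTestFunction Ω φ) :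
    MemLp (gradient φ) 2 (volume : Measure (E d)) :=
  (continuous_gradient h.contDiff_one).memLp_of_hasCompactSupport
    (hasCompactSupport_gradient h.2.1)

theorem IsTestFunction.isWeakGradient (h : IsTestFunction Ω φ) :
    IsWeakGradient (h.memLp.toLp φ) (h.memLp_gradient.toLp (gradient φ)) := by
  intro ψ hψ v
  have h1 : ∫ x, (h.memLp.toLp φ) x * fderiv ℝ ψ x v = ∫ x, φ x * fderiv ℝ ψ x v := by
    refine integral_congr_ae ?_
    filter_upwards [h.memLp.coeFn_toLp] with x hx
    rw [hx]
  have h2 : ∫ x, inner ℝ ((h.memLp_gradient.toLp (gradient φ)) x) v * ψ x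
      = ∫ x, fderiv ℝ φ x v * ψ x := by
    refine integral_congr_ae ?_
    filter_upwards [h.memLp_gradient.coeFn_toLp] with x hx
    rw [hx, inner_gradient_left]
  rw [h1, h2]
  exact integral_mul_fderiv_eq_neg_fderiv_mul_of_integrable
    ((h.memLp_fderiv v).integrable_mul hψ.memLp) (h.memLp.integrable_mul (hψ.memLp_fderiv v))
    (h.memLp.integrable_mul hψ.memLp) (fun x _ => h.1.differentiable (by simp) x)
    (fun x _ => hψ.1.differentiable (by simp) x)

/-- A test function as an element of `H¹(ℝ^d)`. -/
def IsTestFunction.toH1 (h : IsTestFunction Ω φ) : H1 d :=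
  ⟨WithLp.toLp 2 (h.memLp.toLp φ, h.memLp_gradient.toLp (gradient φ)), h.isWeakGradient⟩

theorem IsTestFunction.fn_toH1 (h : IsTestFunction Ω φ) : (fn h.toH1 : E d → ℝ) =ᵐ[volume] φ :=
  h.memLp.coeFn_toLp

theorem IsTestFunction.grad_toH1 (h : IsTestFunction Ω φ) :
    (grad h.toH1 : E d → E d) =ᵐ[volume] gradient φ :=
  h.memLp_gradient.coeFn_toLp

theorem IsTestFunction.toH1_mem (h : IsTestFunction Ω φ) : h.toH1 ∈ testSpace Ω :=
  ⟨φ, h, h.fn_toH1, h.grad_toH1⟩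

theorem norm_sq_eq (u : H1 d) : ‖u‖ ^ 2 = ‖fn u‖ ^ 2 + ‖grad u‖ ^ 2 :=
  WithLp.prod_norm_sq_eq_of_L2 (u : WithLp 2 (L2 d × L2Vec d))

theorem norm_sq_Lp {F : Type*} [NormedAddCommGroup F] [InnerProductSpace ℝ F]
    (g : Lp F 2 (volume : Measure (E d))) : ‖g‖ ^ 2 = ∫ x, ‖g x‖ ^ 2 := by
  rw [← real_inner_self_eq_norm_sq, L2.inner_def]
  simp

theorem H1_ext {u v : H1 d} (h1 : (fn u : E d → ℝ) =ᵐ[volume] fn v)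
    (h2 : (grad u : E d → E d) =ᵐ[volume] grad v) : u = v := by
  have e1 : fn u = fn v := Lp.ext h1
  have e2 : grad u = grad v := Lp.ext h2
  have h : ‖u - v‖ ^ 2 = 0 := by
    rw [norm_sq_eq]
    have e3 : fn (u - v) = fn u - fn v := rfl
    have e4 : grad (u - v) = grad u - grad v := rfl
    rw [e3, e4, e1, e2]
    simp
  exact sub_eq_zero.mp (norm_eq_zero.mp (pow_eq_zero_iff (two_ne_zero) |>.mp h))

theorem mem_testSpace_iff {u : H1 d} :
    u ∈ testSpace Ω ↔ ∃ (φ : E d → ℝ) (h : IsTestFunction Ω φ), u = h.toH1 := by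
  constructor
  · rintro ⟨φ, h, h1, h2⟩
    exact ⟨φ, h, H1_ext (h1.trans h.fn_toH1.symm) (h2.trans h.grad_toH1.symm)⟩
  · rintro ⟨φ, h, rfl⟩
    exact h.toH1_mem

/-- The weak gradient as a continuous linear map. -/
def gradL (d : ℕ) : H1 d →L[ℝ] L2Vec d := (WithLp.sndL 2 ℝ (L2 d) (L2Vec d)).comp (H1 d).subtypeL

/-- The underlying `L²` function as a continuous linear map. -/
def fnL (d : ℕ) : H1 d →L[ℝ] L2 d := (WithLp.fstL 2 ℝ (L2 d) (L2Vec d)).comp (H1 d).subtypeL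

/-- For a fixed test function and direction, both sides of the weak gradient identity are `L²` inner
products with fixed elements, hence continuous. This gives the completeness needed for Lax–Milgram.
-/
theorem isClosed_H1 (d : ℕ) : IsClosed (H1 d : Set (WithLp 2 (L2 d × L2Vec d))) := by
  have hset : (H1 d : Set (WithLp 2 (L2 d × L2Vec d))) =
      ⋂ (φ : E d → ℝ) (_ : IsTestFunction Set.univ φ) (v : E d),
        {w | ∫ x, w.fst x * fderiv ℝ φ x v = - ∫ x, inner ℝ (w.snd x) v * φ x} := by
    ext w
    simp only [Set.mem_iInter, Set.mem_ofPred_eq]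
    rfl
  rw [hset]
  refine isClosed_iInter fun φ => isClosed_iInter fun hφ => isClosed_iInter fun v => ?_
  have hv : MemLp (fun x => φ x • v) 2 (volume : Measure (E d)) :=
    (hφ.1.continuous.smul continuous_const).memLp_of_hasCompactSupport
      (hφ.2.1.smul_right (f' := fun _ => v))
  have e1 : ∀ w : WithLp 2 (L2 d × L2Vec d),
      ∫ x, w.fst x * fderiv ℝ φ x v = inner ℝ ((hφ.memLp_fderiv v).toLp _) w.fst := by
    intro w
    rw [L2.inner_def]
    refine integral_congr_ae ?_
    filter_upwards [(hφ.memLp_fderiv v).coeFn_toLp] with x hx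
    rw [hx]
    simp
  have e2 : ∀ w : WithLp 2 (L2 d × L2Vec d),
      ∫ x, inner ℝ (w.snd x) v * φ x = inner ℝ w.snd (hv.toLp _) := by
    intro w
    rw [L2.inner_def]
    refine integral_congr_ae ?_
    filter_upwards [hv.coeFn_toLp] with x hx
    rw [hx, real_inner_smul_right]
    ring
  simp only [e1, e2]
  have c1 : Continuous fun w : WithLp 2 (L2 d × L2Vec d) => w.fst := by fun_prop
  have c2 : Continuous fun w : WithLp 2 (L2 d × L2Vec d) => w.snd := by fun_prop
  exact isClosed_eq (continuous_const.inner c1) (c2.inner continuous_const).neg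

instance completeSpace_H1 : CompleteSpace (H1 d) := (isClosed_H1 d).completeSpace_coe

theorem isClosed_H10 (Ω : Set (E d)) : IsClosed (H10 Ω : Set (H1 d)) :=
  (testSpace Ω).isClosed_topologicalClosure

theorem testSpace_le_H10 (Ω : Set (E d)) : testSpace Ω ≤ H10 Ω :=
  (testSpace Ω).le_topologicalClosure

theorem H10_mono {Ω Ω' : Set (E d)} (h : Ω ⊆ Ω') : H10 Ω ≤ H10 Ω' :=
  Submodule.topologicalClosure_mono fun _ ⟨φ, hφ, h1, h2⟩ => ⟨φ, hφ.mono h, h1, h2⟩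

theorem exists_test_near {u : H1 d} (hu : u ∈ H10 Ω) {ε : ℝ} (hε : 0 < ε) :
    ∃ (φ : E d → ℝ) (h : IsTestFunction Ω φ), ‖u - h.toH1‖ < ε := by
  have hu' : u ∈ closure (testSpace Ω : Set (H1 d)) := hu
  obtain ⟨w, hw, hd⟩ := Metric.mem_closure_iff.mp hu' ε hε
  obtain ⟨φ, h, rfl⟩ := mem_testSpace_iff.mp hw
  exact ⟨φ, h, by rwa [← dist_eq_norm]⟩

theorem mem_H10_of_near {u : H1 d}
    (h : ∀ ε > 0, ∃ (φ : E d → ℝ) (h : IsTestFunction Ω φ), ‖u - h.toH1‖ < ε) : u ∈ H10 Ω := by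
  refine Metric.mem_closure_iff.mpr fun ε hε => ?_
  obtain ⟨φ, hφ, hlt⟩ := h ε hε
  exact ⟨_, hφ.toH1_mem, by rwa [dist_eq_norm]⟩

theorem IsTestFunction.norm_fn_toH1 (h : IsTestFunction Ω φ) :
    ‖fn h.toH1‖ ^ 2 = ∫ x, φ x ^ 2 := by
  rw [norm_sq_Lp]
  refine integral_congr_ae ?_
  filter_upwards [h.fn_toH1] with x hx
  simp [hx]

theorem IsTestFunction.norm_grad_toH1 (h : IsTestFunction Ω φ) :
    ‖grad h.toH1‖ ^ 2 = ∫ x, ‖gradient φ x‖ ^ 2 := by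
  rw [norm_sq_Lp]
  refine integral_congr_ae ?_
  filter_upwards [h.grad_toH1] with x hx
  simp [hx]

/-! ### Solvability of the Dirichlet problem -/

/-- Lax–Milgram for the form `⟨G u, G v⟩`: the Poincaré-type bound is its coercivity, with constant
`C⁻²`. -/
theorem exists_galerkin_solution {V F : Type*} [NormedAddCommGroup V] [InnerProductSpace ℝ V]
    [CompleteSpace V] [NormedAddCommGroup F] [InnerProductSpace ℝ F] (G : V →L[ℝ] F) {C : ℝ}
    (hC0 : 0 < C) (hC : ∀ x, ‖x‖ ≤ C * ‖G x‖) (ℓ : V →L[ℝ] ℝ) :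
    ∃ u, ∀ x, inner ℝ (G u) (G x) = ℓ x := by
  let B : V →L[ℝ] V →L[ℝ] ℝ := (innerSL ℝ).bilinearComp G G
  have hB : ∀ u v, B u v = inner ℝ (G u) (G v) := fun _ _ => rfl
  have hcoer : IsCoercive B := by
    refine ⟨(C ^ 2)⁻¹, by positivity, fun u => ?_⟩
    rw [hB, real_inner_self_eq_norm_sq, mul_assoc, inv_mul_le_iff₀ (by positivity), ← sq, ← mul_pow]
    exact pow_le_pow_left₀ (norm_nonneg _) (hC u) 2
  refine ⟨hcoer.continuousLinearEquivOfBilin.symm ((InnerProductSpace.toDual ℝ V).symm ℓ),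
    fun v => ?_⟩
  rw [← hB, ← hcoer.continuousLinearEquivOfBilin_apply _ v, ContinuousLinearEquiv.apply_symm_apply,
    InnerProductSpace.toDual_symm_apply]

theorem exists_galerkin_solution_mem {H F : Type*} [NormedAddCommGroup H] [InnerProductSpace ℝ H]
    [CompleteSpace H] [NormedAddCommGroup F] [InnerProductSpace ℝ F] (G : H →L[ℝ] F)
    {V : Submodule ℝ H} (hV : IsClosed (V : Set H)) {C : ℝ} (hC0 : 0 < C)
    (hC : ∀ x ∈ V, ‖x‖ ≤ C * ‖G x‖) (ℓ : H →L[ℝ] ℝ) :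
    ∃ u ∈ V, ∀ x ∈ V, inner ℝ (G u) (G x) = ℓ x := by
  have hcomp : CompleteSpace V := hV.completeSpace_coe
  obtain ⟨u, hu⟩ := exists_galerkin_solution (V := V) (G.comp V.subtypeL) hC0
    (fun x => hC x x.2) (ℓ.comp V.subtypeL)
  exact ⟨u, u.2, fun x hx => hu ⟨x, hx⟩⟩

theorem integral_inner_grad (u v : H1 d) :
    ∫ x, inner ℝ (grad u x) (grad v x) = inner ℝ (grad u) (grad v) :=
  (L2.inner_def _ _).symm

theorem integral_mul_fn (f : L2 d) (v : H1 d) : ∫ x, f x * fn v x = inner ℝ f (fn v) := by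
  rw [L2.inner_def]
  simp [mul_comm]

/-- The Dirichlet problem is uniquely solvable if a Poincaré inequality holds. -/
theorem exists_isUniqueSolution {C : ℝ} (hC0 : 0 < C)
    (hC : ∀ u ∈ H10 Ω, ‖u‖ ≤ C * ‖grad u‖) (f : L2 d) : ∃ u, IsUniqueSolution Ω f u := by
  obtain ⟨u, huΩ, hu⟩ := exists_galerkin_solution_mem (gradL d) (isClosed_H10 Ω) hC0 hC
    ((innerSL ℝ f).comp (fnL d))
  have hsol : ∀ v ∈ H10 Ω, inner ℝ (grad u) (grad v) = inner ℝ f (fn v) := hu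
  refine ⟨u, ⟨huΩ, fun v hv => ?_⟩, fun w hw => ?_⟩
  · rw [integral_mul_fn, integral_inner_grad]
    exact hsol v hv
  · have hz : w - u ∈ H10 Ω := (H10 Ω).sub_mem hw.1 huΩ
    have h1 := hw.2 _ hz
    rw [integral_mul_fn, integral_inner_grad] at h1
    have h3 : inner ℝ (grad (w - u)) (grad (w - u)) = 0 := by
      have : grad (w - u) = grad w - grad u := rfl
      nth_rewrite 1 [this]
      rw [inner_sub_left, h1, hsol _ hz, sub_self]
    have h4 := hC _ hz
    rw [inner_self_eq_zero.mp h3, norm_zero, mul_zero] at h4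
    exact sub_eq_zero.mp (norm_le_zero_iff.mp h4)

/-! ### Poincaré and Hardy inequalities from a radial field -/

/-- Off the support of `φ` the product vanishes locally, so weights and cut-offs need to be regular
only on that support. -/
theorem contDiff_mul_of_contDiffAt_tsupport {n : WithTop ℕ∞} {g : E d → ℝ} (hφ : ContDiff ℝ n φ)
    (hg : ∀ x ∈ tsupport φ, ContDiffAt ℝ n g x) : ContDiff ℝ n fun x => φ x * g x := by
  rw [contDiff_iff_contDiffAt]
  intro x
  by_cases hx : x ∈ tsupport φ
  · exact hφ.contDiffAt.mul (hg x hx)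
  · have h0 := notMem_tsupport_iff_eventuallyEq.mp hx
    refine (contDiffAt_const (c := (0 : ℝ))).congr_of_eventuallyEq ?_
    filter_upwards [h0] with z hz
    simp [hz]

theorem fderiv_eq_zero_of_notMem_tsupport {x : E d} (hx : x ∉ tsupport φ) : fderiv ℝ φ x = 0 :=
  image_eq_zero_of_notMem_tsupport fun h => hx (tsupport_fderiv_subset ℝ h)

theorem hasFDerivAt_norm_sub_sq (p x : E d) :
    HasFDerivAt (fun x => ‖x - p‖ ^ 2) (2 • innerSL ℝ (x - p)) x := by
  simpa using ((hasFDerivAt_id x).sub_const p).norm_sq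

theorem contDiff_norm_sub_sq {n : WithTop ℕ∞} (p : E d) :
    ContDiff ℝ n fun x : E d => ‖x - p‖ ^ 2 :=
  (contDiff_id.sub contDiff_const).norm_sq ℝ

/-- The divergence theorem for the vector field `φ² a(|x - p|²) (x - p)`. -/
theorem integral_divergence_radial (hφ : ContDiff ℝ 1 φ) (hc : HasCompactSupport φ) (p : E d)
    {a : ℝ → ℝ} (ha : ∀ x ∈ tsupport φ, ContDiffAt ℝ 1 a (‖x - p‖ ^ 2)) :
    Integrable (fun x => 2 * φ x * a (‖x - p‖ ^ 2) * fderiv ℝ φ x (x - p)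
      + φ x ^ 2 * (2 * ‖x - p‖ ^ 2 * deriv a (‖x - p‖ ^ 2) + d * a (‖x - p‖ ^ 2))) ∧
    ∫ x, (2 * φ x * a (‖x - p‖ ^ 2) * fderiv ℝ φ x (x - p)
      + φ x ^ 2 * (2 * ‖x - p‖ ^ 2 * deriv a (‖x - p‖ ^ 2) + d * a (‖x - p‖ ^ 2))) = 0 := by
  -- The component of the field along `e`; summing `∂_e (F e)` over an orthonormal basis gives the
  -- divergence.
  let F : E d → E d → ℝ := fun e x => φ x * (φ x * a (‖x - p‖ ^ 2) * inner ℝ e (x - p))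
  have hF : ∀ e, ContDiff ℝ 1 (F e) := by
    intro e
    refine contDiff_mul_of_contDiffAt_tsupport hφ fun x hx => ?_
    refine (hφ.contDiffAt.mul ?_).mul ?_
    · exact (ha x hx).comp x (contDiff_norm_sub_sq p).contDiffAt
    · exact contDiffAt_const.inner ℝ (contDiffAt_id.sub contDiffAt_const)
  have hFc : ∀ e, HasCompactSupport (F e) := fun e => hc.mul_right
  have hFi : ∀ e v, Integrable fun x => fderiv ℝ (F e) x v := fun e v =>
    (((hF e).continuous_fderiv (by simp)).clm_apply
      continuous_const).integrable_of_hasCompactSupport ((hFc e).fderiv_apply ℝ v)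
  have hF' : ∀ e x, fderiv ℝ (F e) x e = 2 * φ x * a (‖x - p‖ ^ 2) *
      (fderiv ℝ φ x e * inner ℝ e (x - p)) + φ x ^ 2 * (2 * inner ℝ e (x - p) ^ 2 *
        deriv a (‖x - p‖ ^ 2) + ‖e‖ ^ 2 * a (‖x - p‖ ^ 2)) := by
    intro e x
    by_cases hx : x ∈ tsupport φ
    · have h1 := (hφ.differentiable (by simp) x).hasFDerivAt
      have h2 := ((ha x hx).differentiableAt (by simp)).hasDerivAt.comp_hasFDerivAt x
        (hasFDerivAt_norm_sub_sq p x)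
      have h3 : HasFDerivAt (fun x : E d => inner ℝ e (x - p)) (innerSL ℝ e) x :=
        (innerSL ℝ e).hasFDerivAt.comp x ((hasFDerivAt_id x).sub_const p)
      have h4 := h1.mul ((h1.mul h2).mul h3)
      rw [show fderiv ℝ (F e) x = _ from h4.fderiv]
      simp only [_root_.add_apply, _root_.smul_apply, innerSL_apply_apply,
        smul_eq_mul, Function.comp_apply, real_inner_self_eq_norm_sq, nsmul_eq_mul, Pi.mul_apply,
        real_inner_comm e (x - p)]
      push_cast
      ring
    · have h0 : x ∉ tsupport (F e) := fun h => hx (tsupport_mul_subset_left h)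
      rw [fderiv_eq_zero_of_notMem_tsupport h0, fderiv_eq_zero_of_notMem_tsupport hx,
        image_eq_zero_of_notMem_tsupport hx]
      simp
  let b := EuclideanSpace.basisFun (Fin d) ℝ
  have hsum : (fun x => 2 * φ x * a (‖x - p‖ ^ 2) * fderiv ℝ φ x (x - p)
      + φ x ^ 2 * (2 * ‖x - p‖ ^ 2 * deriv a (‖x - p‖ ^ 2) + d * a (‖x - p‖ ^ 2))) =
      fun x => ∑ i, fderiv ℝ (F (b i)) x (b i) := by
    funext x
    have e1 : fderiv ℝ φ x (x - p) = ∑ i, fderiv ℝ φ x (b i) * inner ℝ (b i) (x - p) := by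
      conv_lhs => rw [← b.sum_repr' (x - p)]
      simp [mul_comm]
    have e2 : ‖x - p‖ ^ 2 = ∑ i, inner ℝ (b i) (x - p) ^ 2 :=
      (b.sum_sq_inner_right (x - p)).symm
    have e3 : ∑ i, ‖b i‖ ^ 2 = (d : ℝ) := by simp
    simp only [hF', Finset.sum_add_distrib, ← Finset.mul_sum, ← Finset.sum_mul, ← e1, ← e2, e3]
  rw [hsum]
  refine ⟨integrable_finsetSum _ fun i _ => hFi _ _, ?_⟩
  rw [integral_finsetSum _ fun i _ => hFi _ _]
  exact Finset.sum_eq_zero fun i _ => integral_fderiv_apply_eq_zero (hF _) (hFc _) _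

theorem integrable_norm_fderiv_sq (hφ : ContDiff ℝ 1 φ) (hc : HasCompactSupport φ) :
    Integrable fun x => ‖fderiv ℝ φ x‖ ^ 2 := by
  refine Continuous.integrable_of_hasCompactSupport
    ((hφ.continuous_fderiv (by simp)).norm.pow 2) ?_
  exact (hc.fderiv ℝ).comp_left (g := fun L => ‖L‖ ^ 2) (by simp)

/-- Young's inequality, used to absorb the cross term of the divergence into `|∇φ|²`. -/
theorem neg_two_mul_apply_le (L : E d →L[ℝ] ℝ) (y : E d) (c : ℝ) :
    -(2 * c * L y) ≤ c ^ 2 * ‖y‖ ^ 2 + ‖L‖ ^ 2 := by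
  have h1 : |c * L y| ≤ |c| * (‖L‖ * ‖y‖) := by
    rw [abs_mul]
    exact mul_le_mul_of_nonneg_left (L.le_opNorm y) (abs_nonneg c)
  have h2 := sq_nonneg (|c| * ‖y‖ - ‖L‖)
  have h3 := neg_abs_le (c * L y)
  have h4 := sq_abs c
  nlinarith

theorem poincare_test (hd : 2 ≤ d) {p : E d} {R : ℝ} (h : IsTestFunction (Metric.ball p R) φ) :
    ∫ x, φ x ^ 2 ≤ R ^ 2 * ∫ x, ‖fderiv ℝ φ x‖ ^ 2 := by
  obtain ⟨hi, h0⟩ := integral_divergence_radial (a := fun _ => 1) h.contDiff_one h.2.1 p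
    fun x _ => contDiffAt_const
  have hg := (integrable_norm_fderiv_sq h.contDiff_one h.2.1).const_mul (R ^ 2)
  calc ∫ x, φ x ^ 2 ≤ ∫ x, (R ^ 2 * ‖fderiv ℝ φ x‖ ^ 2 + _) := by
        refine integral_mono_of_nonneg (Eventually.of_forall fun x => sq_nonneg _) (hg.add hi)
          (Eventually.of_forall fun x => ?_)
        by_cases hx : x ∈ tsupport φ
        · have hxR : ‖x - p‖ < R := by simpa [dist_eq_norm] using h.2.2 hx
          have hd' : (2 : ℝ) ≤ d := by exact_mod_cast hd
          have hR : 0 < R := (norm_nonneg _).trans_lt hxR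
          have h1 := neg_two_mul_apply_le (R • fderiv ℝ φ x) (R⁻¹ • (x - p)) (φ x)
          have h2 : ‖R⁻¹ • (x - p)‖ ≤ 1 := by
            rw [norm_smul, norm_inv, Real.norm_of_nonneg hR.le]
            exact inv_mul_le_one_of_le₀ hxR.le hR.le
          have h3 : ‖R⁻¹ • (x - p)‖ ^ 2 ≤ 1 := pow_le_one₀ (norm_nonneg _) h2
          have h4 : (R • fderiv ℝ φ x) (R⁻¹ • (x - p)) = fderiv ℝ φ x (x - p) := by
            simp [hR.ne']
          rw [h4, norm_smul R, Real.norm_of_nonneg hR.le, mul_pow] at h1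
          have h5 := mul_le_mul_of_nonneg_left h3 (sq_nonneg (φ x))
          have h6 := mul_le_mul_of_nonneg_left hd' (sq_nonneg (φ x))
          simp only [deriv_const, mul_zero, zero_add, mul_one]
          linarith
        · simp [image_eq_zero_of_notMem_tsupport hx, fderiv_eq_zero_of_notMem_tsupport hx]
    _ = R ^ 2 * ∫ x, ‖fderiv ℝ φ x‖ ^ 2 := by
        rw [integral_add hg hi, h0, add_zero, integral_const_mul]

/-- A Hardy inequality with logarithmic weight, valid in every dimension `d ≥ 2`. -/
theorem hardy_log (hd : 2 ≤ d) (hφ : ContDiff ℝ 1 φ) (hc : HasCompactSupport φ) (p : E d)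
    {M ε : ℝ} (hε : 0 < ε) (hM : ∀ x ∈ tsupport φ, ‖x - p‖ ^ 2 + ε < M) {W : E d → ℝ}
    (hW0 : ∀ x, 0 ≤ W x) (hW : ∀ x ∈ tsupport φ, W x ≤
      ‖x - p‖ ^ 2 * ((‖x - p‖ ^ 2 + ε) * (Real.log M - Real.log (‖x - p‖ ^ 2 + ε)))⁻¹ ^ 2) :
    ∫ x, φ x ^ 2 * W x ≤ ∫ x, ‖fderiv ℝ φ x‖ ^ 2 := by
  -- With `L = log (M / (s + ε))`, `a' = -(L - 1) a²` and `a = a² L (s + ε)`, so `2 s a' + d a ≥ 2 s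
  -- a² + 2 ε L a²`. Young's inequality costs one `s a²`, and the other is the Hardy weight.
  let a : ℝ → ℝ := fun s => ((s + ε) * (Real.log M - Real.log (s + ε)))⁻¹
  have hρ : ∀ x : E d, 0 < ‖x - p‖ ^ 2 + ε := fun x => by positivity
  have hL : ∀ x ∈ tsupport φ, 0 < Real.log M - Real.log (‖x - p‖ ^ 2 + ε) := fun x hx =>
    sub_pos.mpr (Real.log_lt_log (hρ x) (hM x hx))
  have ha : ∀ x ∈ tsupport φ, ContDiffAt ℝ 1 a (‖x - p‖ ^ 2) := by
    intro x hx
    have h1 : ContDiffAt ℝ 1 (fun s : ℝ => s + ε) (‖x - p‖ ^ 2) := contDiffAt_id.add contDiffAt_const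
    refine (h1.mul (contDiffAt_const.sub (h1.log (hρ x).ne'))).inv ?_
    exact (mul_pos (hρ x) (hL x hx)).ne'
  have ha' : ∀ x ∈ tsupport φ, deriv a (‖x - p‖ ^ 2) =
      -(Real.log M - Real.log (‖x - p‖ ^ 2 + ε) - 1) * a (‖x - p‖ ^ 2) ^ 2 := by
    intro x hx
    have h1 : HasDerivAt (fun s : ℝ => s + ε) 1 (‖x - p‖ ^ 2) := (hasDerivAt_id _).add_const ε
    have h2 := (h1.mul ((h1.log (hρ x).ne').const_sub (Real.log M))).inv
      (mul_pos (hρ x) (hL x hx)).ne'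
    rw [show deriv a (‖x - p‖ ^ 2) = _ from h2.deriv]
    have := (hρ x).ne'
    have := (hL x hx).ne'
    simp only [a, Pi.mul_apply]
    field_simp
    ring
  obtain ⟨hi, h0⟩ := integral_divergence_radial hφ hc p ha
  have hg := integrable_norm_fderiv_sq hφ hc
  calc ∫ x, φ x ^ 2 * W x ≤ ∫ x, (‖fderiv ℝ φ x‖ ^ 2 + _) := by
        refine integral_mono_of_nonneg
          (Eventually.of_forall fun x => mul_nonneg (sq_nonneg _) (hW0 x)) (hg.add hi)
          (Eventually.of_forall fun x => ?_)
        by_cases hx : x ∈ tsupport φ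
        · have hd' : (2 : ℝ) ≤ d := by exact_mod_cast hd
          have h1 := neg_two_mul_apply_le (fderiv ℝ φ x) (x - p) (φ x * a (‖x - p‖ ^ 2))
          have hρx := hρ x
          have hLx := hL x hx
          have hapos : 0 < a (‖x - p‖ ^ 2) := inv_pos.mpr (mul_pos hρx hLx)
          have haL : a (‖x - p‖ ^ 2) * ((‖x - p‖ ^ 2 + ε) *
              (Real.log M - Real.log (‖x - p‖ ^ 2 + ε))) = 1 :=
            inv_mul_cancel₀ (mul_pos hρx hLx).ne'
          have h2 := mul_le_mul_of_nonneg_left (hW x hx) (sq_nonneg (φ x))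
          have h3 : 2 * ‖x - p‖ ^ 2 * a (‖x - p‖ ^ 2) ^ 2 ≤
              2 * ‖x - p‖ ^ 2 * deriv a (‖x - p‖ ^ 2) + d * a (‖x - p‖ ^ 2) := by
            rw [ha' x hx]
            set L := Real.log M - Real.log (‖x - p‖ ^ 2 + ε)
            set A := a (‖x - p‖ ^ 2)
            set s := ‖x - p‖ ^ 2
            have h4 : 0 ≤ A ^ 2 * L * (2 * ε) := by positivity
            have h5 : 2 * A ≤ d * A := mul_le_mul_of_nonneg_right hd' hapos.le
            have h6 : A = A ^ 2 * L * (s + ε) := by linear_combination (-A) * haL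
            nlinarith
          have h7 := mul_le_mul_of_nonneg_left h3 (sq_nonneg (φ x))
          have h8 : φ x ^ 2 * W x ≤ φ x ^ 2 * (‖x - p‖ ^ 2 * a (‖x - p‖ ^ 2) ^ 2) := h2
          show φ x ^ 2 * W x ≤ ‖fderiv ℝ φ x‖ ^ 2 + (_ + _)
          linarith
        · simp [image_eq_zero_of_notMem_tsupport hx, fderiv_eq_zero_of_notMem_tsupport hx]
    _ = ∫ x, ‖fderiv ℝ φ x‖ ^ 2 := by
        rw [integral_add hg hi, h0, add_zero]

/-! ### Points have zero capacity -/

theorem exists_bound_deriv_smoothTransition :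
    ∃ D : ℝ, 0 ≤ D ∧ ∀ x, |deriv Real.smoothTransition x| ≤ D := by
  have hcont : Continuous (deriv Real.smoothTransition) :=
    (Real.smoothTransition.contDiff (n := 1)).continuous_deriv (by simp)
  obtain ⟨D, hD⟩ := isCompact_Icc.exists_bound_of_continuousOn
    (s := Set.Icc (0 : ℝ) 1) hcont.continuousOn
  refine ⟨D, (norm_nonneg _).trans (hD 0 (by simp)), fun x => ?_⟩
  have h0 : |(0 : ℝ)| ≤ D := by
    rw [abs_zero]
    exact (norm_nonneg _).trans (hD 0 (by simp))
  rcases lt_or_ge x 0 with hx | hx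
  · have : Real.smoothTransition =ᶠ[𝓝 x] fun _ => 0 := by
      filter_upwards [Iio_mem_nhds hx] with z hz
      exact Real.smoothTransition.zero_of_nonpos (le_of_lt hz)
    rw [this.deriv_eq, deriv_const]
    exact h0
  rcases lt_or_ge 1 x with hx1 | hx1
  · have : Real.smoothTransition =ᶠ[𝓝 x] fun _ => 1 := by
      filter_upwards [Ioi_mem_nhds hx1] with z hz
      exact Real.smoothTransition.one_of_one_le (le_of_lt hz)
    rw [this.deriv_eq, deriv_const]
    exact h0
  · exact hD x ⟨hx, hx1⟩

/-- Points have zero capacity in dimension `d ≥ 2`, in the form of cut-off functions at `p` that act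
with a small error on all test functions of a fixed ball. -/
theorem exists_cutoff (hd : 2 ≤ d) (p : E d) {R : ℝ} (hR : 0 < R) {τ : ℝ} (hτ : 0 < τ) :
    ∃ r > 0, ∃ σ : E d → ℝ, (∀ x ∈ Metric.ball p R, ContDiffAt ℝ ∞ σ x) ∧
      (∀ x, 0 ≤ σ x ∧ σ x ≤ 1) ∧ (∀ x ∈ Metric.ball p r, σ x = 1) ∧
      (∀ x ∈ Metric.ball p R, τ ≤ ‖x - p‖ → σ x = 0) ∧
      ∀ φ, IsTestFunction (Metric.ball p R) φ →
        ∫ x, φ x ^ 2 * ‖fderiv ℝ σ x‖ ^ 2 ≤ τ * ∫ x, ‖fderiv ℝ φ x‖ ^ 2 := by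
  obtain ⟨D, hD0, hD⟩ := exists_bound_deriv_smoothTransition
  set M : ℝ := 2 * R ^ 2 with hMdef
  have hM : 0 < M := by positivity
  -- The summands serve in turn to make `k` positive, to make the cut-off vanish at distance at
  -- least `τ`, and to ensure `(2 D / k)² ≤ τ`.
  set k : ℝ := 1 + |Real.log M - Real.log (τ ^ 2)| + 4 * D ^ 2 / τ with hkdef
  have hDτ : 0 ≤ 4 * D ^ 2 / τ := by positivity
  have hk1 : 1 ≤ k := by
    have := abs_nonneg (Real.log M - Real.log (τ ^ 2))
    linarith
  have hk0 : 0 < k := by linarith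
  have hk2 : Real.log M - Real.log (τ ^ 2) ≤ k := by
    have := le_abs_self (Real.log M - Real.log (τ ^ 2))
    linarith
  have hk3 : (2 * D / k) ^ 2 ≤ τ := by
    have h1 : 4 * D ^ 2 / τ ≤ k := by
      have := abs_nonneg (Real.log M - Real.log (τ ^ 2))
      linarith
    rw [div_le_iff₀ hτ] at h1
    rw [div_pow, div_le_iff₀ (by positivity)]
    nlinarith
  -- Makes `L 0 = exp (2 k) + 1`; the extra `1` leaves room for `L > exp (2 k)`, hence `σ = 1`, on a
  -- whole ball around `p`.
  set ε : ℝ := Real.exp (Real.log M - (Real.exp (2 * k) + 1)) with hεdef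
  have hε : 0 < ε := Real.exp_pos _
  have hεR : ε < R ^ 2 := by
    have h1 : ε = M * Real.exp (-(Real.exp (2 * k) + 1)) := by
      rw [hεdef, sub_eq_add_neg, Real.exp_add, Real.exp_log hM]
    have h2 : Real.exp (-(Real.exp (2 * k) + 1)) < 1 / 2 := by
      rw [Real.exp_neg, one_div]
      refine inv_strictAnti₀ (by norm_num) ?_
      have h3 := Real.add_one_le_exp (Real.exp (2 * k) + 1)
      have h4 := Real.exp_pos (2 * k)
      linarith
    rw [h1, hMdef]
    have : 0 < R ^ 2 := by positivity
    nlinarith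
  let L : ℝ → ℝ := fun s => Real.log M - Real.log (s + ε)
  -- `σ` climbs from `0` to `1` as `log L` goes from `k` to `2 k`. The gradient of the double
  -- logarithm has, up to a constant, the square root of the Hardy weight as its size, and the
  -- factor `1 / k` makes it small.
  let σ : E d → ℝ := fun x => Real.smoothTransition (Real.log (L (‖x - p‖ ^ 2)) / k - 1)
  have hρ : ∀ x : E d, 0 < ‖x - p‖ ^ 2 + ε := fun x => by positivity
  have hball : ∀ x ∈ Metric.ball p R, ‖x - p‖ ^ 2 + ε < M := by
    intro x hx
    have hxR : ‖x - p‖ < R := by simpa [dist_eq_norm] using hx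
    have := pow_lt_pow_left₀ hxR (norm_nonneg _) two_ne_zero
    linarith
  have hL : ∀ x ∈ Metric.ball p R, 0 < L (‖x - p‖ ^ 2) := fun x hx =>
    sub_pos.mpr (Real.log_lt_log (hρ x) (hball x hx))
  have hLp : Real.exp (2 * k) < L (‖p - p‖ ^ 2) := by
    simp only [L, sub_self, norm_zero, ne_eq, OfNat.ofNat_ne_zero, not_false_eq_true, zero_pow,
      zero_add, hεdef, Real.log_exp]
    linarith
  have hLcont : ContinuousAt (fun x => L (‖x - p‖ ^ 2)) p :=
    continuousAt_const.sub
      (((contDiff_norm_sub_sq (n := 0) p).continuous.continuousAt.add continuousAt_const).log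
        (hρ p).ne')
  obtain ⟨r, hr, hrL⟩ := Metric.eventually_nhds_iff_ball.mp (hLcont.eventually_const_lt hLp)
  refine ⟨r, hr, σ, fun x hx => ?_, fun x => ?_, fun x hx => ?_, fun x hx hxτ => ?_,
    fun φ hφ => ?_⟩
  · refine Real.smoothTransition.contDiff.contDiffAt.comp x ?_
    have h1 : ContDiffAt ℝ ∞ (fun x => L (‖x - p‖ ^ 2)) x := contDiffAt_const.sub
      (((contDiff_norm_sub_sq p).contDiffAt.add contDiffAt_const).log (hρ x).ne')
    exact ((h1.log (hL x hx).ne').div_const k).sub contDiffAt_const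
  · exact ⟨Real.smoothTransition.nonneg _, Real.smoothTransition.le_one _⟩
  · refine Real.smoothTransition.one_of_one_le ?_
    have h1 : 2 * k ≤ Real.log (L (‖x - p‖ ^ 2)) :=
      (Real.le_log_iff_exp_le ((Real.exp_pos _).trans (hrL x hx))).mpr (hrL x hx).le
    have h2 : 2 ≤ Real.log (L (‖x - p‖ ^ 2)) / k := (le_div_iff₀ hk0).mpr h1
    linarith
  · refine Real.smoothTransition.zero_of_nonpos ?_
    have h1 : Real.log (L (‖x - p‖ ^ 2)) ≤ k := by
      have h2 := Real.log_le_sub_one_of_pos (hL x hx)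
      have h3 : Real.log (τ ^ 2) ≤ Real.log (‖x - p‖ ^ 2 + ε) :=
        Real.log_le_log (by positivity)
          ((pow_le_pow_left₀ hτ.le hxτ 2).trans (le_add_of_nonneg_right hε.le))
      simp only [L] at h2 ⊢
      linarith
    have h2 : Real.log (L (‖x - p‖ ^ 2)) / k ≤ 1 := (div_le_one hk0).mpr h1
    linarith
  · have hσ : ∀ x ∈ Metric.ball p R, ‖fderiv ℝ σ x‖ ^ 2 ≤
        τ * (‖x - p‖ ^ 2 * ((‖x - p‖ ^ 2 + ε) * L (‖x - p‖ ^ 2))⁻¹ ^ 2) := by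
      intro x hx
      have hLx := hL x hx
      have hρx := hρ x
      have h1 : HasDerivAt (fun s : ℝ => s + ε) 1 (‖x - p‖ ^ 2) := (hasDerivAt_id _).add_const ε
      have h2 : HasDerivAt (fun s => Real.log (L s) / k - 1)
          (-(1 / (‖x - p‖ ^ 2 + ε)) / L (‖x - p‖ ^ 2) / k) (‖x - p‖ ^ 2) :=
        ((((h1.log hρx.ne').const_sub (Real.log M)).log hLx.ne').div_const k).sub_const 1
      have h3 := ((Real.smoothTransition.contDiff (n := 1)).differentiable (by simp)
        (Real.log (L (‖x - p‖ ^ 2)) / k - 1)).hasDerivAt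
      have h4 := (HasDerivAt.comp (‖x - p‖ ^ 2) h3 h2).comp_hasFDerivAt x
        (hasFDerivAt_norm_sub_sq p x)
      rw [show fderiv ℝ σ x = _ from h4.fderiv]
      have h5 := hD (Real.log (L (‖x - p‖ ^ 2)) / k - 1)
      set D' := deriv Real.smoothTransition (Real.log (L (‖x - p‖ ^ 2)) / k - 1)
      have h6 : ‖(2 : ℕ) • innerSL ℝ (x - p)‖ = 2 * ‖x - p‖ := by
        rw [← Nat.cast_smul_eq_nsmul ℝ, norm_smul, innerSL_apply_norm]
        simp
      have h7 : D' ^ 2 ≤ D ^ 2 := sq_le_sq' (neg_le_of_abs_le h5) (le_of_abs_le h5)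
      rw [norm_smul, h6, mul_pow, Real.norm_eq_abs, sq_abs]
      have h8 : (D' * (-(1 / (‖x - p‖ ^ 2 + ε)) / L (‖x - p‖ ^ 2) / k)) ^ 2 * (2 * ‖x - p‖) ^ 2
          = (4 * D' ^ 2 / k ^ 2) *
            (‖x - p‖ ^ 2 * ((‖x - p‖ ^ 2 + ε) * L (‖x - p‖ ^ 2))⁻¹ ^ 2) := by
        field_simp
        ring
      rw [h8]
      refine mul_le_mul_of_nonneg_right (le_trans ?_ hk3) (by positivity)
      rw [div_pow, mul_pow]
      gcongr
      norm_num
    have hH := hardy_log hd hφ.contDiff_one hφ.2.1 p hε (fun x hx => hball x (hφ.2.2 hx))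
      (W := fun x => τ⁻¹ * ‖fderiv ℝ σ x‖ ^ 2) (fun x => by positivity)
      (fun x hx => (inv_mul_le_iff₀ hτ).mpr (hσ x (hφ.2.2 hx)))
    have hrew : ∫ x, φ x ^ 2 * (τ⁻¹ * ‖fderiv ℝ σ x‖ ^ 2) =
        τ⁻¹ * ∫ x, φ x ^ 2 * ‖fderiv ℝ σ x‖ ^ 2 := by
      rw [← integral_const_mul]
      congr 1
      funext x
      ring
    rw [hrew, inv_mul_le_iff₀ hτ] at hH
    exact hH

/-- Both sides are continuous in `H¹`, so test functions suffice; for them `R² + 1 ≤ (R + 1)²`. The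
constant depends only on the enclosing ball. -/
theorem poincare_H10 (hd : 2 ≤ d) {p : E d} {R : ℝ} (hR : 0 < R) (hΩ : Ω ⊆ Metric.ball p R)
    (u : H1 d) (hu : u ∈ H10 Ω) : ‖u‖ ≤ (R + 1) * ‖grad u‖ := by
  have hcl : IsClosed {u : H1 d | ‖u‖ ≤ (R + 1) * ‖gradL d u‖} :=
    isClosed_le continuous_norm (continuous_const.mul (gradL d).continuous.norm)
  refine closure_minimal (s := (testSpace Ω : Set (H1 d))) ?_ hcl hu
  intro w hw
  obtain ⟨φ, h, rfl⟩ := mem_testSpace_iff.mp hw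
  show ‖h.toH1‖ ≤ (R + 1) * ‖grad h.toH1‖
  refine le_of_sq_le_sq ?_ (by positivity)
  have h1 := poincare_test hd (h.mono hΩ)
  have h2 := h.norm_grad_toH1
  simp only [norm_gradient] at h2
  rw [norm_sq_eq, h.norm_fn_toH1, mul_pow, h2]
  rw [← h2] at h1 ⊢
  have h3 : 0 ≤ 2 * R * ‖grad h.toH1‖ ^ 2 := by positivity
  nlinarith

/-! ### Removing a point does not change `H¹₀` -/

theorem IsTestFunction.toH1_sub {Ω' Ω'' : Set (E d)} {ψ χ : E d → ℝ} (h₁ : IsTestFunction Ω φ)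
    (h₂ : IsTestFunction Ω' ψ) (h₃ : IsTestFunction Ω'' χ) (h : ∀ x, χ x = φ x - ψ x) :
    h₁.toH1 - h₂.toH1 = h₃.toH1 := by
  obtain rfl : χ = φ - ψ := funext h
  refine H1_ext ?_ ?_
  · refine (Lp.coeFn_sub (fn h₁.toH1) (fn h₂.toH1)).trans ?_
    exact (h₁.fn_toH1.sub h₂.fn_toH1).trans h₃.fn_toH1.symm
  · refine (Lp.coeFn_sub (grad h₁.toH1) (grad h₂.toH1)).trans ?_
    refine (h₁.grad_toH1.sub h₂.grad_toH1).trans (EventuallyEq.trans ?_ h₃.grad_toH1.symm)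
    refine Eventually.of_forall fun x => ?_
    have e1 := h₁.1.differentiable (by simp) x
    have e2 := h₂.1.differentiable (by simp) x
    simp [gradient, fderiv_sub e1 e2]

theorem integrable_norm_sq {F : Type*} [NormedAddCommGroup F]
    (g : Lp F 2 (volume : Measure (E d))) : Integrable fun x => ‖g x‖ ^ 2 :=
  (Lp.memLp g).integrable_norm_pow (by simp)

/-- Transfers smallness of the local mass from `u` to a test function that is chosen only after the
ball. -/
theorem setIntegral_norm_sq_le {F : Type*} [NormedAddCommGroup F] [InnerProductSpace ℝ F]
    (g h : Lp F 2 (volume : Measure (E d))) (B : Set (E d)) :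
    ∫ x in B, ‖h x‖ ^ 2 ≤ 2 * (∫ x in B, ‖g x‖ ^ 2) + 2 * ‖g - h‖ ^ 2 := by
  have hg := integrable_norm_sq g
  have hh := integrable_norm_sq h
  have hgh := integrable_norm_sq (g - h)
  have h1 : ∫ x in B, ‖h x‖ ^ 2 ≤ ∫ x in B, (2 * ‖g x‖ ^ 2 + 2 * ‖(g - h : Lp F 2 _) x‖ ^ 2) := by
    refine integral_mono_ae hh.integrableOn
      ((hg.const_mul 2).add (hgh.const_mul 2)).integrableOn ?_
    refine ae_restrict_of_ae ?_
    filter_upwards [Lp.coeFn_sub g h] with x hx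
    have h2 : ‖h x‖ ≤ ‖g x‖ + ‖(g - h : Lp F 2 _) x‖ := by
      rw [hx, Pi.sub_apply]
      exact norm_le_norm_add_norm_sub (g x) (h x)
    have h3 := pow_le_pow_left₀ (norm_nonneg _) h2 2
    have h4 := sq_nonneg (‖g x‖ - ‖(g - h : Lp F 2 _) x‖)
    nlinarith
  have h5 : ∫ x in B, ‖(g - h : Lp F 2 _) x‖ ^ 2 ≤ ‖g - h‖ ^ 2 := by
    rw [norm_sq_Lp]
    exact setIntegral_le_integral hgh (Eventually.of_forall fun x => sq_nonneg _)
  rw [integral_add (hg.const_mul 2).integrableOn (hgh.const_mul 2).integrableOn,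
    integral_const_mul, integral_const_mul] at h1
  linarith

/-- The cut-off `σ` of `exists_cutoff` acts on test functions with a small error. -/
theorem norm_sq_cutoff_le {p : E d} {R τ : ℝ} {σ : E d → ℝ}
    (hσ : ∀ x ∈ Metric.ball p R, ContDiffAt ℝ ∞ σ x) (hσ01 : ∀ x, 0 ≤ σ x ∧ σ x ≤ 1)
    (hσ0 : ∀ x ∈ Metric.ball p R, τ ≤ ‖x - p‖ → σ x = 0)
    (h : IsTestFunction (Metric.ball p R) φ)
    (hcap : ∫ x, φ x ^ 2 * ‖fderiv ℝ σ x‖ ^ 2 ≤ τ * ∫ x, ‖fderiv ℝ φ x‖ ^ 2)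
    (h' : IsTestFunction Set.univ fun x => φ x * σ x) :
    ‖h'.toH1‖ ^ 2 ≤ 2 * ((∫ x in Metric.ball p τ, ‖fn h.toH1 x‖ ^ 2) +
      ∫ x in Metric.ball p τ, ‖grad h.toH1 x‖ ^ 2) + 2 * τ * ‖grad h.toH1‖ ^ 2 := by
  have hB : MeasurableSet (Metric.ball p τ) := measurableSet_ball
  have hσB : ∀ x ∈ tsupport φ, σ x ^ 2 ≤ (Metric.ball p τ).indicator (fun _ => (1 : ℝ)) x := by
    intro x hx
    by_cases hxτ : x ∈ Metric.ball p τ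
    · rw [Set.indicator_of_mem hxτ]
      exact pow_le_one₀ (hσ01 x).1 (hσ01 x).2
    · rw [Set.indicator_of_notMem hxτ, hσ0 x (h.2.2 hx)]
      · simp
      · simpa [dist_eq_norm] using hxτ
  have e1 : ∫ x in Metric.ball p τ, ‖fn h.toH1 x‖ ^ 2 =
      ∫ x, φ x ^ 2 * (Metric.ball p τ).indicator (fun _ => (1 : ℝ)) x := by
    rw [← integral_indicator hB]
    refine integral_congr_ae ?_
    filter_upwards [h.fn_toH1] with x hx
    by_cases hxτ : x ∈ Metric.ball p τ <;> simp [hxτ, hx]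
  have e2 : ∫ x in Metric.ball p τ, ‖grad h.toH1 x‖ ^ 2 =
      ∫ x, ‖fderiv ℝ φ x‖ ^ 2 * (Metric.ball p τ).indicator (fun _ => (1 : ℝ)) x := by
    rw [← integral_indicator hB]
    refine integral_congr_ae ?_
    filter_upwards [h.grad_toH1] with x hx
    by_cases hxτ : x ∈ Metric.ball p τ <;> simp [hxτ, hx, norm_gradient]
  have e3 : ‖grad h.toH1‖ ^ 2 = ∫ x, ‖fderiv ℝ φ x‖ ^ 2 := by
    simp only [h.norm_grad_toH1, norm_gradient]
  have e4 : ‖grad h'.toH1‖ ^ 2 = ∫ x, ‖fderiv ℝ (fun x => φ x * σ x) x‖ ^ 2 := by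
    simp only [h'.norm_grad_toH1, norm_gradient]
  have i0 : Integrable fun x => φ x ^ 2 := h.memLp.integrable_sq
  have i1 : Integrable fun x => φ x ^ 2 * (Metric.ball p τ).indicator (fun _ => (1 : ℝ)) x := by
    refine (i0.indicator hB).congr (Eventually.of_forall fun x => ?_)
    by_cases hxτ : x ∈ Metric.ball p τ <;> simp [hxτ]
  have i2 : Integrable fun x =>
      ‖fderiv ℝ φ x‖ ^ 2 * (Metric.ball p τ).indicator (fun _ => (1 : ℝ)) x := by
    refine ((integrable_norm_fderiv_sq h.contDiff_one h.2.1).indicator hB).congr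
      (Eventually.of_forall fun x => ?_)
    by_cases hxτ : x ∈ Metric.ball p τ <;> simp [hxτ]
  have i3 : Integrable fun x => φ x ^ 2 * ‖fderiv ℝ σ x‖ ^ 2 := by
    refine Continuous.integrable_of_hasCompactSupport ?_ ?_
    · rw [continuous_iff_continuousAt]
      intro x
      by_cases hx : x ∈ tsupport φ
      · have h1 : ContinuousAt (fderiv ℝ σ) x :=
          ((hσ x (h.2.2 hx)).fderiv_right (m := 0) (by simp)).continuousAt
        exact (h.1.continuous.continuousAt.pow 2).mul (h1.norm.pow 2)
      · refine (continuousAt_const (y := (0 : ℝ))).congr ?_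
        filter_upwards [notMem_tsupport_iff_eventuallyEq.mp hx] with z hz
        simp [hz]
    · have h1 : HasCompactSupport fun x => φ x ^ 2 :=
        h.2.1.comp_left (g := fun y : ℝ => y ^ 2) (by simp)
      exact h1.mul_right
  have f1 : ∫ x, (φ x * σ x) ^ 2 ≤
      ∫ x, φ x ^ 2 * (Metric.ball p τ).indicator (fun _ => (1 : ℝ)) x := by
    refine integral_mono_of_nonneg (Eventually.of_forall fun x => sq_nonneg _) i1
      (Eventually.of_forall fun x => ?_)
    by_cases hx : x ∈ tsupport φ
    · simp only [mul_pow]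
      exact mul_le_mul_of_nonneg_left (hσB x hx) (sq_nonneg _)
    · simp [image_eq_zero_of_notMem_tsupport hx]
  -- Of the two terms of the product rule, `σ ∇φ` lives in the ball of radius `τ`, and `φ ∇σ` is
  -- what `hcap` controls.
  have f2 : ∫ x, ‖fderiv ℝ (fun x => φ x * σ x) x‖ ^ 2 ≤
      ∫ x, (2 * (‖fderiv ℝ φ x‖ ^ 2 * (Metric.ball p τ).indicator (fun _ => (1 : ℝ)) x) +
        2 * (φ x ^ 2 * ‖fderiv ℝ σ x‖ ^ 2)) := by
    refine integral_mono_of_nonneg (Eventually.of_forall fun x => sq_nonneg _)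
      ((i2.const_mul 2).add (i3.const_mul 2)) (Eventually.of_forall fun x => ?_)
    by_cases hx : x ∈ tsupport φ
    · have h1 := h.1.differentiable (by simp) x
      have h2 := (hσ x (h.2.2 hx)).differentiableAt (by simp)
      have h3 : ‖fderiv ℝ (fun x => φ x * σ x) x‖ ≤
          |φ x| * ‖fderiv ℝ σ x‖ + |σ x| * ‖fderiv ℝ φ x‖ := by
        rw [fderiv_fun_mul h1 h2]
        refine (norm_add_le _ _).trans ?_
        rw [norm_smul, norm_smul, Real.norm_eq_abs, Real.norm_eq_abs]
      have h4 := pow_le_pow_left₀ (norm_nonneg _) h3 2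
      have h5 := sq_nonneg (|φ x| * ‖fderiv ℝ σ x‖ - |σ x| * ‖fderiv ℝ φ x‖)
      have h6 := mul_le_mul_of_nonneg_left (hσB x hx) (sq_nonneg ‖fderiv ℝ φ x‖)
      have h7 := sq_abs (φ x)
      have h8 := sq_abs (σ x)
      simp only
      calc _ ≤ (|φ x| * ‖fderiv ℝ σ x‖ + |σ x| * ‖fderiv ℝ φ x‖) ^ 2 := h4
        _ ≤ 2 * (|φ x| * ‖fderiv ℝ σ x‖) ^ 2 + 2 * (|σ x| * ‖fderiv ℝ φ x‖) ^ 2 := by linarith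
        _ = 2 * (φ x ^ 2 * ‖fderiv ℝ σ x‖ ^ 2) + 2 * (‖fderiv ℝ φ x‖ ^ 2 * σ x ^ 2) := by
            rw [mul_pow, mul_pow, h7, h8]
            ring
        _ ≤ _ := by linarith
    · have h0 : x ∉ tsupport fun x => φ x * σ x := fun h => hx (tsupport_mul_subset_left h)
      simp [image_eq_zero_of_notMem_tsupport hx, fderiv_eq_zero_of_notMem_tsupport hx,
        fderiv_eq_zero_of_notMem_tsupport h0]
  rw [integral_add (i2.const_mul 2) (i3.const_mul 2), integral_const_mul, integral_const_mul,
    ← e2, ← e4] at f2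
  rw [← h'.norm_fn_toH1, ← e1] at f1
  rw [← e3] at hcap
  have f0 : 0 ≤ ∫ x in Metric.ball p τ, ‖fn h.toH1 x‖ ^ 2 :=
    integral_nonneg fun x => sq_nonneg _
  rw [norm_sq_eq]
  linarith

theorem tendsto_setIntegral_ball_zero (hd : 2 ≤ d) (p : E d) {f : E d → ℝ} (hf : Integrable f) :
    Tendsto (fun τ => ∫ x in Metric.ball p τ, f x) (𝓝[>] 0) (𝓝 0) := by
  refine hf.tendsto_setIntegral_nhds_zero ?_
  have h1 : Tendsto (fun τ : ℝ => ENNReal.ofReal (τ ^ d) * volume (Metric.ball (0 : E d) 1))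
      (𝓝[>] 0) (𝓝 (ENNReal.ofReal (0 ^ d) * volume (Metric.ball (0 : E d) 1))) := by
    refine ENNReal.Tendsto.mul_const ?_ (Or.inr measure_ball_lt_top.ne)
    exact ENNReal.tendsto_ofReal
      ((tendsto_nhdsWithin_of_tendsto_nhds tendsto_id : Tendsto (fun τ : ℝ => τ) _ _).pow d)
  rw [zero_pow (by omega), ENNReal.ofReal_zero, zero_mul] at h1
  refine h1.congr' ?_
  filter_upwards [self_mem_nhdsWithin] with τ hτ
  rw [Function.comp_apply, Measure.addHaar_ball_of_pos _ _ hτ, finrank_euclideanSpace_fin]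

/-- Stability of `H¹₀` under removal of smaller and smaller balls around a point. -/
theorem mem_H10_of_punctured (hd : 2 ≤ d) {p : E d} {R : ℝ} (hR : 0 < R) {Ω' : Set (E d)}
    {u : H1 d} (hu : ∀ r > 0, ∃ Ω ⊆ Metric.ball p R, u ∈ H10 Ω ∧ Ω \ Metric.ball p r ⊆ Ω') :
    u ∈ H10 Ω' := by
  refine mem_H10_of_near fun ε hε => ?_
  let A : ℝ → ℝ := fun τ => (∫ x in Metric.ball p τ, ‖fn u x‖ ^ 2) +
    ∫ x in Metric.ball p τ, ‖grad u x‖ ^ 2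
  have hA : Tendsto A (𝓝[>] 0) (𝓝 (0 + 0)) :=
    (tendsto_setIntegral_ball_zero hd p (integrable_norm_sq (fn u))).add
      (tendsto_setIntegral_ball_zero hd p (integrable_norm_sq (grad u)))
  have hid : Tendsto (fun τ : ℝ => τ) (𝓝[>] 0) (𝓝 0) := tendsto_nhdsWithin_of_tendsto_nhds tendsto_id
  have hE : Tendsto (fun τ => 4 * A τ + 4 * τ ^ 2 + 2 * τ * (‖u‖ + τ) ^ 2) (𝓝[>] 0) (𝓝 0) := by
    have := ((hA.const_mul 4).add ((hid.pow 2).const_mul 4)).add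
      ((hid.const_mul 2).mul ((hid.const_add ‖u‖).pow 2))
    simpa using this
  have hev : ∀ᶠ τ in 𝓝[>] (0 : ℝ), 0 < τ ∧ τ < ε / 2 ∧
      4 * A τ + 4 * τ ^ 2 + 2 * τ * (‖u‖ + τ) ^ 2 < (ε / 2) ^ 2 :=
    (eventually_mem_nhdsWithin).and ((hid.eventually_lt_const (by positivity)).and
      (hE.eventually_lt_const (by positivity)))
  -- The order of choices matters: `τ` depends on `u` and `ε` only, then come `r` and `σ`, then `Ω`,
  -- and last `φ`. The bound on the cut-off is uniform in `φ`.
  obtain ⟨τ, hτ, hτε, hτA⟩ := hev.exists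
  obtain ⟨r, hr, σ, hσ, hσ01, hσ1, hσ0, hcap⟩ := exists_cutoff hd p hR hτ
  obtain ⟨Ω, hΩR, huΩ, hΩ'⟩ := hu r hr
  obtain ⟨φ, hφ, hφu⟩ := exists_test_near huΩ hτ
  have hφR := hφ.mono hΩR
  have hσφ : ∀ x ∈ tsupport φ, ContDiffAt ℝ ∞ σ x := fun x hx => hσ x (hφR.2.2 hx)
  have h' : IsTestFunction Set.univ fun x => φ x * σ x :=
    ⟨contDiff_mul_of_contDiffAt_tsupport hφ.1 hσφ, hφ.2.1.mul_right, Set.subset_univ _⟩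
  have h'' : IsTestFunction Ω' fun x => φ x * (1 - σ x) := by
    refine ⟨contDiff_mul_of_contDiffAt_tsupport hφ.1 fun x hx => contDiffAt_const.sub (hσφ x hx),
      hφ.2.1.mul_right, fun x hx => hΩ' ⟨hφ.2.2 (tsupport_mul_subset_left hx), ?_⟩⟩
    have hsub : tsupport (fun x => φ x * (1 - σ x)) ⊆ (Metric.ball p r)ᶜ := by
      refine closure_minimal (fun z hz hzr => hz ?_) Metric.isOpen_ball.isClosed_compl
      simp [hσ1 z hzr]
    exact hsub hx
  refine ⟨_, h'', ?_⟩
  have hsub : hφR.toH1 - h''.toH1 = h'.toH1 := hφR.toH1_sub h'' h' fun x => by ring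
  have hcut := norm_sq_cutoff_le hσ hσ01 hσ0 hφR (hcap φ hφR) h'
  have hφu' : ‖u - hφR.toH1‖ < τ := hφu
  have hdiff := norm_sq_eq (u - hφR.toH1)
  have hfn := setIntegral_norm_sq_le (fn u) (fn hφR.toH1) (Metric.ball p τ)
  have hgr := setIntegral_norm_sq_le (grad u) (grad hφR.toH1) (Metric.ball p τ)
  have hdiff' : ‖u - hφR.toH1‖ ^ 2 = ‖fn u - fn hφR.toH1‖ ^ 2 + ‖grad u - grad hφR.toH1‖ ^ 2 :=
    hdiff
  have hτ2 : ‖u - hφR.toH1‖ ^ 2 < τ ^ 2 := pow_lt_pow_left₀ hφu' (norm_nonneg _) two_ne_zero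
  have hφn : ‖grad hφR.toH1‖ ^ 2 ≤ (‖u‖ + τ) ^ 2 := by
    have h1 : ‖grad hφR.toH1‖ ^ 2 ≤ ‖hφR.toH1‖ ^ 2 := by
      rw [norm_sq_eq hφR.toH1]
      linarith [sq_nonneg ‖fn hφR.toH1‖]
    have h2 : ‖hφR.toH1‖ ≤ ‖u‖ + τ :=
      (norm_le_norm_add_norm_sub u hφR.toH1).trans (by linarith)
    exact h1.trans (pow_le_pow_left₀ (norm_nonneg _) h2 2)
  have hφn' := mul_le_mul_of_nonneg_left hφn (by linarith : 0 ≤ 2 * τ)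
  have hfin : ‖h'.toH1‖ < ε / 2 := by
    refine lt_of_pow_lt_pow_left₀ 2 (by positivity) ?_
    simp only [A] at hτA
    linarith
  calc ‖u - h''.toH1‖ = ‖(u - hφR.toH1) + h'.toH1‖ := by rw [← hsub, sub_add_sub_cancel]
    _ ≤ ‖u - hφR.toH1‖ + ‖h'.toH1‖ := norm_add_le _ _
    _ < ε := by linarith

/-! ### Absence of jumps for the curve family -/

/-- The open sets obtained from `Ω₁` by removing the final part of a curve outside `Ω₀`. -/
def curveFamily (Ω₀ Ω₁ : Set (E d)) (γ : ℝ → E d) (t : unitInterval) : Set (E d) :=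
  Ω₀ ∪ (Ω₁ \ γ '' Set.Icc (t : ℝ) 1)

section curveFamily

variable {Ω₀ Ω₁ : Set (E d)} {γ : ℝ → E d}

theorem curveFamily_mono : Monotone (curveFamily Ω₀ Ω₁ γ) := fun _ _ hst =>
  Set.union_subset_union_right _
    (Set.sdiff_subset_sdiff_right (Set.image_mono (Set.Icc_subset_Icc_left hst)))

theorem isOpen_curveFamily (h₀ : IsOpen Ω₀) (h₁ : IsOpen Ω₁) (hγ : Continuous γ)
    (t : unitInterval) : IsOpen (curveFamily Ω₀ Ω₁ γ t) :=
  h₀.union (h₁.sdiff (isCompact_Icc.image hγ).isClosed)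

/-- A point avoiding `γ` on `[t, 1]` also avoids it shortly before `t`, by continuity at `t`. -/
theorem exists_lt_mem_curveFamily (hγ : Continuous γ) {t : unitInterval} (ht : 0 < t) {x : E d}
    (hx : x ∈ curveFamily Ω₀ Ω₁ γ t) : ∃ s < t, x ∈ curveFamily Ω₀ Ω₁ γ s := by
  rcases hx with hx | ⟨hx, hxγ⟩
  · exact ⟨0, ht, Or.inl hx⟩
  · have hne : γ t ≠ x := fun h => hxγ ⟨t, ⟨le_rfl, t.2.2⟩, h⟩
    obtain ⟨δ, hδ, hball⟩ :=
      Metric.eventually_nhds_iff_ball.mp (hγ.continuousAt.eventually_ne hne)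
    have ht' : (0 : ℝ) < t := ht
    refine ⟨⟨max 0 (t - δ / 2), le_max_left _ _, max_le zero_le_one (by linarith [t.2.2])⟩,
      show max 0 ((t : ℝ) - δ / 2) < t from max_lt ht' (by linarith), Or.inr ⟨hx, ?_⟩⟩
    rintro ⟨z, ⟨hz1, hz2⟩, rfl⟩
    rcases lt_or_ge z t with hzt | hzt
    · refine hball z ?_ rfl
      have : (t : ℝ) - δ / 2 ≤ z := (le_max_right _ _).trans hz1
      rw [Metric.mem_ball, Real.dist_eq, abs_lt]
      constructor <;> linarith
    · exact hxγ ⟨z, ⟨hzt, hz2⟩, rfl⟩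

theorem exists_H10_curveFamily_left (h₀ : IsOpen Ω₀) (h₁ : IsOpen Ω₁) (hγ : Continuous γ)
    {t : unitInterval} (ht : 0 < t) {u : H1 d} (hu : u ∈ H10 (curveFamily Ω₀ Ω₁ γ t)) {ε : ℝ}
    (hε : 0 < ε) : ∃ s < t, ∃ v ∈ H10 (curveFamily Ω₀ Ω₁ γ s), ‖u - v‖ < ε := by
  obtain ⟨φ, hφ, hlt⟩ := exists_test_near hu hε
  have : Nonempty (Set.Iio t) := ⟨⟨0, ht⟩⟩
  obtain ⟨s, hs⟩ := hφ.2.1.isCompact.elim_directed_cover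
    (fun s : Set.Iio t => curveFamily Ω₀ Ω₁ γ s) (fun s => isOpen_curveFamily h₀ h₁ hγ s)
    (fun x hx => by
      obtain ⟨s, hs, hxs⟩ := exists_lt_mem_curveFamily hγ ht (hφ.2.2 hx)
      exact Set.mem_iUnion.mpr ⟨⟨s, hs⟩, hxs⟩)
    ((curveFamily_mono.comp (Subtype.mono_coe _)).directed_le)
  have hφs : IsTestFunction (curveFamily Ω₀ Ω₁ γ s) φ := ⟨hφ.1, hφ.2.1, hs⟩
  exact ⟨s, s.2, hφs.toH1, testSpace_le_H10 _ hφs.toH1_mem, hlt⟩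

theorem mem_H10_curveFamily_right (hd : 2 ≤ d) (hb₁ : Bornology.IsBounded Ω₁) (hsub : Ω₀ ⊆ Ω₁)
    (hγ : Continuous γ) {t : unitInterval} (ht : t < 1) {u : H1 d}
    (hu : ∀ s, t < s → u ∈ H10 (curveFamily Ω₀ Ω₁ γ s)) : u ∈ H10 (curveFamily Ω₀ Ω₁ γ t) := by
  obtain ⟨R, hR, hΩR⟩ := hb₁.subset_ball_lt 0 (γ t)
  refine mem_H10_of_punctured hd hR (p := γ t) fun r hr => ?_
  -- The arc of `γ` between `t` and a nearby `s` stays in the ball of radius `r` about `γ t`, so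
  -- outside that ball `Ω_s` is contained in `Ω_t`.
  obtain ⟨δ, hδ, hball⟩ := Metric.continuousAt_iff.mp (hγ.continuousAt (x := (t : ℝ))) r hr
  have ht' : (t : ℝ) < 1 := ht
  let s : unitInterval := ⟨min 1 (t + δ / 2), le_min zero_le_one (by linarith [t.2.1]),
    min_le_left _ _⟩
  have hts : t < s := show (t : ℝ) < min 1 (t + δ / 2) from lt_min ht' (by linarith)
  refine ⟨_, ?_, hu s hts, ?_⟩
  · exact (Set.union_subset hsub Set.sdiff_subset).trans hΩR
  · rintro x ⟨hx | ⟨hx, hxγ⟩, hxr⟩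
    · exact Or.inl hx
    · refine Or.inr ⟨hx, ?_⟩
      rintro ⟨z, ⟨hz1, hz2⟩, rfl⟩
      rcases lt_or_ge z s with hzs | hzs
      · refine hxr (hball ?_)
        have : z < t + δ / 2 := hzs.trans_le (min_le_right _ _)
        rw [Real.dist_eq, abs_lt]
        constructor <;> linarith
      · exact hxγ ⟨z, ⟨hzs, hz2⟩, rfl⟩

end curveFamily

end Dirichlet

end

/-! ### Proof of the theorem -/

theorem theorem01 (d : ℕ) (hd : 2 ≤ d) (Ω₀ Ω₁ : Set (Dirichlet.E d))
    (h₀ : IsOpen Ω₀) (h₁ : IsOpen Ω₁)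
    (hb₀ : Bornology.IsBounded Ω₀) (hb₁ : Bornology.IsBounded Ω₁) (hsub : Ω₀ ⊆ Ω₁) :
    ∃ Ω : unitInterval → Set (Dirichlet.E d),
      Ω 0 = Ω₀ ∧ Ω 1 = Ω₁ ∧
      (∀ t, IsOpen (Ω t)) ∧
      (∀ s t, s < t → Ω s ⊆ Ω t) ∧
      Dirichlet.GammaContinuous Ω ∧
      -- moreover the solutions depend continuously on `t` in the norm of `H¹(ℝ^d)`
      (∀ f : Dirichlet.L2 d, ∃ u : unitInterval → Dirichlet.H1 d,
        (∀ t, Dirichlet.IsUniqueSolution (Ω t) f (u t)) ∧ Continuous u) := by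
  open Dirichlet in
  have : Nontrivial (E d) := by
    have : Nonempty (Fin d) := ⟨⟨0, by omega⟩⟩
    infer_instance
  obtain ⟨q, hq⟩ : ∃ q, q ∉ Ω₁ := by
    by_contra! hall
    exact NormedSpace.unbounded_univ ℝ (E d) (hb₁.subset fun x _ => hall x)
  obtain ⟨γ, hγ, hγΩ, hγ1⟩ := exists_spaceFilling_curve hb₁ q
  obtain ⟨R, hR, hΩR⟩ := hb₁.subset_ball_lt 0 0
  have hfam : ∀ t, curveFamily Ω₀ Ω₁ γ t ⊆ Metric.ball 0 R := fun t =>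
    (Set.union_subset hsub Set.sdiff_subset).trans hΩR
  have hP : ∀ t, ∀ u ∈ H10 (curveFamily Ω₀ Ω₁ γ t), ‖u‖ ≤ (R + 1) * ‖grad u‖ := fun t =>
    poincare_H10 hd hR (hfam t)
  have hnorm : ∀ f : L2 d, ∃ u : unitInterval → H1 d,
      (∀ t, IsUniqueSolution (curveFamily Ω₀ Ω₁ γ t) f (u t)) ∧ Continuous u := by
    intro f
    choose u hu using fun t => exists_isUniqueSolution (by positivity) (hP t) f
    refine ⟨u, hu, ?_⟩
    refine continuous_galerkin (gradL d) (fun t => H10 (curveFamily Ω₀ Ω₁ γ t))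
      (fun s t hst => H10_mono (curveFamily_mono hst)) (fun t => isClosed_H10 _)
      (by positivity : 0 ≤ R + 1) hP (fun v => inner ℝ f (fn v)) u (fun t => (hu t).1.1) ?_ ?_ ?_
    · intro t v hv
      have h := (hu t).1.2 v hv
      rwa [integral_mul_fn, integral_inner_grad] at h
    · intro t ht v hv ε hε
      exact exists_H10_curveFamily_left h₀ h₁ hγ ht hv hε
    · intro t ht v hv
      exact mem_H10_curveFamily_right hd hb₁ hsub hγ ht hv
  refine ⟨curveFamily Ω₀ Ω₁ γ, ?_, ?_, isOpen_curveFamily h₀ h₁ hγ,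
    fun s t hst => curveFamily_mono hst.le, ?_, hnorm⟩
  · refine Set.union_eq_self_of_subset_right ?_
    rintro x ⟨hx, hxγ⟩
    exact absurd (hγΩ hx) hxγ
  · have h1 : Ω₁ \ γ '' Set.Icc ((1 : unitInterval) : ℝ) 1 = Ω₁ := by
      simp [hγ1, hq]
    rw [curveFamily, h1]
    exact Set.union_eq_self_of_subset_left hsub
  · intro t t' ht f
    obtain ⟨u, hu, huc⟩ := hnorm f
    -- Norm continuity composed with a continuous functional gives weak convergence.
    exact ⟨fun n => u (t n), u t', fun n => hu _, hu _, fun ℓ =>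
      ((ℓ.continuous.comp huc).tendsto t').comp ht⟩
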